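/- Let $F$ be a field of characteristic $0$, let $d,n$ be positive integers, and let $F\langle x_1,\ldots,x_{d^2}\rangle$ be the free associative $F$-algebra. For $G\in F\langle x_1,\ldots,x_{d^2}\rangle^{\otimes n}$ and matrices $x_1,\ldots,x_{d^2}\in M_d(F)$, let $G(x_1,\ldots,x_{d^2})\in M_d(F)^{\otimes n}$ be the image of $G$ under $\pi^{\otimes n}$, where $\pi:F\langle x_1,\ldots,x_{d^2}\rangle\to M_d(F)$ is the algebra homomorphism that evaluates the variables at the given matrices. Suppose that the function $G:M_d(F)^{d^2}\to M_d(F)^{\otimes n}$ is multilinear (additive in each variable) and alternating, i.e. $G(x_{\sigma(1)},\ldots,x_{\sigma(d^2)})=\epsilon_\sigma\,G(x_1,\ldots,x_{d^2})$ for all $\sigma\in S_{d^2}$, where $\epsilon_\sigma$ is the sign of $\sigma$. Let $\det(x_1,\ldots,x_{d^2})$ denote the determinant of the $d^2\times d^2$ matrix whose columns are the coordinate vectors of $x_1,\ldots,x_{d^2}$ in the basis of elementary matrices $e_{i,j}$ ordered lexicographically. Identify $M_d(F)^{\otimes n}$ with $\operatorname{End}((F^d)^{\otimes n})$, and let $\Sigma_n(F^d)\subset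 M_d(F)^{\otimes n}$ be the subalgebra spanned by the operators by which the permutations in $S_n$ permute the tensor factors of $(F^d)^{\otimes n}$. Then there is an element $J_G\in M_d(F)^{\otimes n}$ such that $$G(x_1,\ldots,x_{d^2})=\det(x_1,\ldots,x_{d^2})\,J_G\qquad\text{for all }x_1,\ldots,x_{d^2}\in M_d(F),$$ $J_G$ is invariant under the diagonal action of $GL_d(F)$, i.e. $g^{\otimes n}J_G\,(g^{-1})^{\otimes n}=J_G$ for all $g\in GL_d(F)$, and $J_G\in\Sigma_n(F^d)$, i.e. $J_G$ is an $F$-linear combination of permutations. -/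

import Mathlib

open scoped TensorProduct

namespace TensorPoly

/-- Tensor polynomials: the `n`-fold tensor power of the free algebra on variables indexed by `X`. -/
abbrev TPoly (F : Type*) [Field F] (X : Type*) (n : ℕ) : Type _ :=
  ⨂[F] _ : Fin n, FreeAlgebra F X

/-- The `n`-fold tensor power of the algebra of `d × d` matrices. -/
abbrev MatPow (F : Type*) [Field F] (d n : ℕ) : Type _ :=
  ⨂[F] _ : Fin n, Matrix (Fin d) (Fin d) F

/-- The `n`-fold tensor power of the space `F ^ d`. -/
abbrev VecPow (F : Type*) [Field F] (d n : ℕ) : Type _ :=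
  ⨂[F] _ : Fin n, (Fin d → F)

/-- Evaluation of a tensor polynomial at matrices: the `n`-fold tensor power of the algebra
homomorphism from the free algebra to matrices that sends each variable to its value. -/
noncomputable def evalT {F : Type*} [Field F] {X : Type*} {d n : ℕ}
    (G : TPoly F X n) (x : X → Matrix (Fin d) (Fin d) F) : MatPow F d n :=
  PiTensorProduct.map (fun _ : Fin n => (FreeAlgebra.lift F x).toLinearMap) G

/-- A function of several vector variables is multilinear if it is additive in each variable.
(For a polynomial function over a field of characteristic zero, homogeneity is automatic.) -/
def IsMultiadditive {ι U V : Type*} [DecidableEq ι] [Add U] [Add V]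
    (f : (ι → U) → V) : Prop :=
  ∀ (x : ι → U) (i : ι) (a b : U),
    f (Function.update x i (a + b)) = f (Function.update x i a) + f (Function.update x i b)

/-- A function of several variables is alternating (antisymmetric) if permuting the variables
multiplies it by the sign of the permutation. -/
def IsAntisymmetric (F : Type*) [Field F] {ι U V : Type*} [DecidableEq ι] [Fintype ι]
    [SMul F V] (f : (ι → U) → V) : Prop :=
  ∀ (π : Equiv.Perm ι) (x : ι → U),
    f (fun i => x (π i)) = ((Equiv.Perm.sign π : ℤ) : F) • f x

/-- The column vector of a `d × d` matrix, in the basis of elementary matrices `e i j` ordered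
lexicographically. -/
def vec {F : Type*} {d : ℕ} (x : Matrix (Fin d) (Fin d) F) : Fin (d * d) → F :=
  fun p => x (finProdFinEquiv.symm p).1 (finProdFinEquiv.symm p).2

/-- The determinant of `d * d` matrices of size `d × d`, viewed as column vectors. -/
def detVec {F : Type*} [Field F] {d : ℕ}
    (x : Fin (d * d) → Matrix (Fin d) (Fin d) F) : F :=
  Matrix.det (Matrix.of fun p q : Fin (d * d) => vec (x q) p)

/-- The diagonal element `g ⊗ ⋯ ⊗ g` of the tensor power of the matrix algebra. -/
noncomputable def diag {F : Type*} [Field F] {d : ℕ} (n : ℕ) (g : Matrix (Fin d) (Fin d) F) :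
    MatPow F d n :=
  PiTensorProduct.tprod F (fun _ : Fin n => g)

/-- Invariance under the diagonal (conjugation) action of the general linear group. -/
def IsGLInvariant {F : Type*} [Field F] {d n : ℕ} (J : MatPow F d n) : Prop :=
  ∀ g : Matrix.GeneralLinearGroup (Fin d) F,
    diag n (g : Matrix (Fin d) (Fin d) F) * J *
      diag n ((g⁻¹ : Matrix.GeneralLinearGroup (Fin d) F) : Matrix (Fin d) (Fin d) F) = J

/-- The canonical identification of the tensor power of the matrix algebra with the endomorphisms
of the tensor power of `F ^ d`:
`(A₁ ⊗ ⋯ ⊗ Aₙ) (v₁ ⊗ ⋯ ⊗ vₙ) = A₁ v₁ ⊗ ⋯ ⊗ Aₙ vₙ`. -/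
noncomputable def toEnd (F : Type*) [Field F] (d n : ℕ) :
    MatPow F d n →ₗ[F] Module.End F (VecPow F d n) :=
  PiTensorProduct.piTensorHomMap ∘ₗ
    PiTensorProduct.map (fun _ : Fin n => (Matrix.toLin' (R := F) (m := Fin d) (n := Fin d)).toLinearMap)

theorem toEnd_tprod (F : Type*) [Field F] (d n : ℕ) (A : Fin n → Matrix (Fin d) (Fin d) F)
    (v : Fin n → Fin d → F) :
    toEnd F d n (PiTensorProduct.tprod F A) (PiTensorProduct.tprod F v) =
      PiTensorProduct.tprod F (fun i => (A i).mulVec (v i)) := by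
  simp [toEnd]

/-- The operator permuting the tensor factors: the factor in position `i` moves to
position `σ i`. -/
noncomputable def permOp (F : Type*) [Field F] (d : ℕ) {n : ℕ} (σ : Equiv.Perm (Fin n)) :
    Module.End F (VecPow F d n) :=
  (PiTensorProduct.reindex F (fun _ : Fin n => (Fin d → F)) σ).toLinearMap

theorem permOp_tprod (F : Type*) [Field F] (d : ℕ) {n : ℕ} (σ : Equiv.Perm (Fin n))
    (v : Fin n → Fin d → F) :
    permOp F d σ (PiTensorProduct.tprod F v) = PiTensorProduct.tprod F (fun i => v (σ.symm i)) := by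
  simp [permOp]

theorem permOp_one (F : Type*) [Field F] (d n : ℕ) :
    permOp F d (1 : Equiv.Perm (Fin n)) = 1 := by
  refine PiTensorProduct.ext (MultilinearMap.ext fun v => ?_)
  simp only [LinearMap.compMultilinearMap_apply, permOp_tprod]
  rfl

theorem permOp_mul (F : Type*) [Field F] (d : ℕ) {n : ℕ} (σ τ : Equiv.Perm (Fin n)) :
    permOp F d (σ * τ) = permOp F d σ * permOp F d τ := by
  refine PiTensorProduct.ext (MultilinearMap.ext fun v => ?_)
  simp only [LinearMap.compMultilinearMap_apply, Module.End.mul_apply, permOp_tprod]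
  rfl

/-- The algebra spanned by the permutation operators. -/
noncomputable def permAlgebra (F : Type*) [Field F] (d n : ℕ) :
    Subalgebra F (Module.End F (VecPow F d n)) :=
  (Submodule.span F (Set.range (permOp F d (n := n)))).toSubalgebra
    (Submodule.subset_span ⟨1, permOp_one F d n⟩)
    (by
      intro a b ha hb
      induction ha, hb using Submodule.span_induction₂ with
      | mem_mem a b ha hb =>
        obtain ⟨σ, rfl⟩ := ha
        obtain ⟨τ, rfl⟩ := hb
        exact Submodule.subset_span ⟨σ * τ, permOp_mul F d σ τ⟩
      | zero_left b hb => rw [zero_mul]; exact Submodule.zero_mem _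
      | zero_right a ha => rw [mul_zero]; exact Submodule.zero_mem _
      | add_left a b c _ _ _ h1 h2 => rw [add_mul]; exact Submodule.add_mem _ h1 h2
      | add_right a b c _ _ _ h1 h2 => rw [mul_add]; exact Submodule.add_mem _ h1 h2
      | smul_left r a b _ _ h => rw [smul_mul_assoc]; exact Submodule.smul_mem _ r h
      | smul_right r a b _ _ h => rw [mul_smul_comm]; exact Submodule.smul_mem _ r h)

end TensorPoly

/-! An additive polynomial function in characteristic zero is homogeneous, so `G` defines an
alternating multilinear map on the `d * d`-dimensional space of matrices. Such a map is the
determinant times its value `J` on the elementary matrices. Conjugating all variables by `g`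
conjugates the evaluation by `g ⊗ ⋯ ⊗ g` but leaves the determinant unchanged, so `J` is invariant.
The rest is Schur–Weyl duality. By polarization and Zariski density of invertible matrices, the
operators `g ⊗ ⋯ ⊗ g` span the commutant of the symmetric group. Hence `J` lies in the double
commutant, which Maschke's theorem and Jacobson density identify with the span of the permutations.
-/

namespace TensorPoly

/-! ### Polynomial functions of one variable -/

/-- A function `F → F` that is given by a polynomial. -/
def IsPolyFun {F : Type*} [Field F] (f : F → F) : Prop :=
  ∃ p : Polynomial F, ∀ t, f t = p.eval t

namespace IsPolyFun

variable {F : Type*} [Field F] {f g : F → F}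

theorem const (c : F) : IsPolyFun fun _ : F => c := ⟨Polynomial.C c, by simp⟩

theorem id : IsPolyFun fun t : F => t := ⟨Polynomial.X, by simp⟩

theorem add (hf : IsPolyFun f) (hg : IsPolyFun g) : IsPolyFun fun t => f t + g t := by
  obtain ⟨p, hp⟩ := hf
  obtain ⟨q, hq⟩ := hg
  exact ⟨p + q, by simp [hp, hq]⟩

theorem mul (hf : IsPolyFun f) (hg : IsPolyFun g) : IsPolyFun fun t => f t * g t := by
  obtain ⟨p, hp⟩ := hf
  obtain ⟨q, hq⟩ := hg
  exact ⟨p * q, by simp [hp, hq]⟩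

theorem sum {ι : Type*} {s : Finset ι} {f : ι → F → F} (h : ∀ i ∈ s, IsPolyFun (f i)) :
    IsPolyFun fun t => ∑ i ∈ s, f i t := by
  choose! p hp using h
  refine ⟨∑ i ∈ s, p i, fun t => ?_⟩
  rw [Polynomial.eval_finsetSum]
  exact Finset.sum_congr rfl fun i hi => hp i hi t

theorem prod {ι : Type*} {s : Finset ι} {f : ι → F → F} (h : ∀ i ∈ s, IsPolyFun (f i)) :
    IsPolyFun fun t => ∏ i ∈ s, f i t := by
  choose! p hp using h
  refine ⟨∏ i ∈ s, p i, fun t => ?_⟩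
  rw [Polynomial.eval_prod]
  exact Finset.prod_congr rfl fun i hi => hp i hi t

/-- A polynomial function vanishing on an infinite set vanishes. -/
theorem eq_zero_of_infinite (hf : IsPolyFun f) (h : {t | f t = 0}.Infinite) (t : F) : f t = 0 := by
  obtain ⟨p, hp⟩ := hf
  have : p = 0 := by
    refine Polynomial.eq_of_infinite_eval_eq p 0 (h.mono fun s hs => ?_)
    simpa [← hp] using hs
  simp [hp, this]

/-- An additive polynomial function in characteristic zero is homogeneous. -/
theorem eq_mul_of_additive [CharZero F] (hf : IsPolyFun f) (h : ∀ s t, f (s + t) = f s + f t)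
    (t : F) : f t = t * f 1 := by
  have hn : ∀ k : ℕ, f k = k * f 1 := by
    intro k
    simpa using map_nsmul (AddMonoidHom.mk' f h) k 1
  -- The defect `f t - t * f 1` vanishes at every natural number, an infinite set in characteristic
  -- zero.
  have hg : IsPolyFun fun t => f t + -(f 1) * t := hf.add ((const _).mul id)
  have := hg.eq_zero_of_infinite
    (Set.infinite_of_injective_forall_mem Nat.cast_injective fun k : ℕ => by simp [hn, mul_comm]) t
  linear_combination this

/-- Polynomial curves, plugged into a multilinear form, give a polynomial function. -/
theorem multilinearMap {ι κ V : Type*} [Fintype ι] [Fintype κ] [AddCommGroup V] [Module F V]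
    (e : Module.Basis κ F V) (m : MultilinearMap F (fun _ : ι => V) F) {c : ι → F → V}
    (h : ∀ i k, IsPolyFun fun t => e.repr (c i t) k) :
    IsPolyFun fun t => m fun i => c i t := by
  classical
  have key : ∀ t, (m fun i => c i t) =
      ∑ r : ι → κ, (∏ i, e.repr (c i t) (r i)) * m fun i => e (r i) := by
    intro t
    conv_lhs => rw [show (fun i => c i t) = fun i => ∑ k, e.repr (c i t) k • e k from
      funext fun i => (e.sum_repr (c i t)).symm]
    rw [m.map_sum]
    exact Finset.sum_congr rfl fun r _ => m.map_smul_univ _ _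
  simp only [key]
  exact sum fun r _ => (prod fun i _ => h i (r i)).mul (const _)

end IsPolyFun

/-! ### Polynomiality and homogeneity of evaluation -/

section Evaluation

variable {F : Type*} [Field F] {d n : ℕ} {X : Type*}

/-- A form on a tensor power of a matrix algebra is polynomial along polynomial curves of pure
tensors. -/
theorem isPolyFun_dual_tprod (ψ : Module.Dual F (MatPow F d n))
    {c : Fin n → F → Matrix (Fin d) (Fin d) F} (h : ∀ i a b, IsPolyFun fun t => c i t a b) :
    IsPolyFun fun t => ψ (PiTensorProduct.tprod F fun i => c i t) :=
  IsPolyFun.multilinearMap (Matrix.stdBasis F (Fin d) (Fin d))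
    (ψ.compMultilinearMap (PiTensorProduct.tprod F)) fun i k => h i k.1 k.2

theorem isPolyFun_lift_apply {x : F → X → Matrix (Fin d) (Fin d) F}
    (h : ∀ j a b, IsPolyFun fun t => x t j a b) (w : FreeAlgebra F X) (a b : Fin d) :
    IsPolyFun fun t => FreeAlgebra.lift F (x t) w a b := by
  induction w using FreeAlgebra.induction generalizing a b with
  | grade0 r => simpa [Matrix.algebraMap_matrix_apply] using IsPolyFun.const _
  | grade1 j => simpa using h j a b
  | mul u v hu hv =>
    simp only [map_mul, Matrix.mul_apply]
    exact IsPolyFun.sum fun k _ => (hu a k).mul (hv k b)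
  | add u v hu hv =>
    simp only [map_add, Matrix.add_apply]
    exact (hu a b).add (hv a b)

theorem evalT_tprod (w : Fin n → FreeAlgebra F X) (x : X → Matrix (Fin d) (Fin d) F) :
    evalT (PiTensorProduct.tprod F w) x =
      PiTensorProduct.tprod F fun i => FreeAlgebra.lift F x (w i) := by
  simp [evalT]

theorem isPolyFun_dual_evalT (G : TPoly F X n) (ψ : Module.Dual F (MatPow F d n))
    {x : F → X → Matrix (Fin d) (Fin d) F} (h : ∀ j a b, IsPolyFun fun t => x t j a b) :
    IsPolyFun fun t => ψ (evalT G (x t)) := by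
  induction G using PiTensorProduct.induction_on with
  | smul_tprod r w =>
    have : ∀ t, ψ (evalT (r • PiTensorProduct.tprod F w) (x t)) =
        r * ψ (PiTensorProduct.tprod F fun i => FreeAlgebra.lift F (x t) (w i)) := by
      intro t
      rw [← evalT_tprod, evalT, map_smul, map_smul]
      rfl
    simp only [this]
    exact (IsPolyFun.const r).mul (isPolyFun_dual_tprod ψ fun i => isPolyFun_lift_apply h (w i))
  | add G H hG hH =>
    have : ∀ t, ψ (evalT (G + H) (x t)) = ψ (evalT G (x t)) + ψ (evalT H (x t)) := by
      intro t
      simp only [evalT, map_add]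
    simp only [this]
    exact hG.add hH

/-- In characteristic zero a multiadditive tensor polynomial function is homogeneous in each
variable. -/
theorem evalT_update_smul [CharZero F] [DecidableEq X] (G : TPoly F X n)
    (hG : IsMultiadditive fun x : X → Matrix (Fin d) (Fin d) F => evalT G x)
    (x : X → Matrix (Fin d) (Fin d) F) (j : X) (t : F) (a : Matrix (Fin d) (Fin d) F) :
    evalT G (Function.update x j (t • a)) = t • evalT G (Function.update x j a) := by
  -- Linear forms separate vectors, which reduces homogeneity to scalar polynomial functions.
  rw [← sub_eq_zero, ← Module.forall_dual_apply_eq_zero_iff F]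
  intro ψ
  have hpoly : IsPolyFun fun s => ψ (evalT G (Function.update x j (s • a))) := by
    refine isPolyFun_dual_evalT G ψ fun k p q => ?_
    by_cases hk : k = j
    · subst hk
      simpa using IsPolyFun.id.mul (IsPolyFun.const (a p q))
    · simpa [Function.update_of_ne hk] using IsPolyFun.const (x k p q)
  have := hpoly.eq_mul_of_additive (fun s t => by rw [add_smul, ← map_add]; exact congrArg ψ (hG x j _ _)) t
  rw [map_sub, map_smul, this, one_smul, smul_eq_mul, sub_self]

end Evaluation

/-! ### Polarization -/

/-- Polarization: the symmetrization of a multilinear map is an alternating sum of values on the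
diagonal. -/
theorem sum_powerset_map_diagonal {R ι V W : Type*} [CommRing R] [Fintype ι] [DecidableEq ι]
    [AddCommGroup V] [Module R V] [AddCommGroup W] [Module R W]
    (m : MultilinearMap R (fun _ : ι => V) W) (v : ι → V) :
    ∑ T : Finset ι, (-1 : ℤ) ^ T.card • m (fun _ => ∑ j ∈ Tᶜ, v j) =
      ∑ σ : Equiv.Perm ι, m fun i => v (σ i) := by
  have h1 : ∀ T : Finset ι, (-1 : ℤ) ^ T.card • m (fun _ => ∑ j ∈ Tᶜ, v j) =
      ∑ r : ι → ι, if T ⊆ (Finset.univ.image r)ᶜ then (-1 : ℤ) ^ T.card • m (fun i => v (r i))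
        else 0 := by
    intro T
    rw [m.map_sum_finset (fun _ j => v j) fun _ => Tᶜ, Finset.smul_sum, ← Finset.sum_filter]
    refine Finset.sum_congr ?_ fun _ _ => rfl
    ext r
    simp only [Fintype.mem_piFinset, Finset.mem_compl, Finset.mem_filter, Finset.mem_univ, true_and]
    rw [Finset.subset_compl_comm]
    simp [Finset.subset_iff]
  simp only [h1]
  rw [Finset.sum_comm]
  -- Inclusion–exclusion: for fixed `r` the signs run over all subsets of the complement of its
  -- image, and cancel unless `r` is onto, hence bijective.
  have h2 : ∀ r : ι → ι, (∑ T : Finset ι, if T ⊆ (Finset.univ.image r)ᶜ then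
      (-1 : ℤ) ^ T.card • m (fun i => v (r i)) else 0) =
      if Function.Bijective r then m (fun i => v (r i)) else 0 := by
    intro r
    have hr : (Finset.univ.image r)ᶜ = ∅ ↔ Function.Bijective r := by
      rw [Finset.compl_eq_empty_iff, ← Finset.coe_eq_univ, Finset.coe_image, Finset.coe_univ, Set.image_univ, Set.range_eq_univ,
        Finite.surjective_iff_bijective]
    rw [← Finset.sum_filter, ← Finset.sum_smul]
    have : (Finset.univ.filter fun T : Finset ι => T ⊆ (Finset.univ.image r)ᶜ) =
        ((Finset.univ.image r)ᶜ).powerset := by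
      ext; simp
    rw [this, Finset.sum_powerset_neg_one_pow_card]
    simp only [hr, ite_smul, one_smul, zero_smul]
  simp only [h2]
  rw [← Finset.sum_filter]
  symm
  refine Finset.sum_bij (fun (σ : Equiv.Perm ι) _ => (σ : ι → ι)) ?_ ?_ ?_ ?_
  · intro σ _
    simp
  · intro σ _ τ _ h
    exact DFunLike.coe_injective h
  · intro r hr
    exact ⟨Equiv.ofBijective r (by simpa using hr), by simp, rfl⟩
  · intro σ _
    rfl

/-! ### The commutant of the symmetric group -/

section

variable {F : Type*} [Field F] {d n : ℕ}

theorem toEnd_mul (S T : MatPow F d n) : toEnd F d n (S * T) = toEnd F d n S * toEnd F d n T := by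
  induction S using PiTensorProduct.induction_on with
  | add a b ha hb => simp only [add_mul, map_add, ha, hb]
  | smul_tprod r A =>
    induction T using PiTensorProduct.induction_on with
    | add a b ha hb => simp only [mul_add, map_add, ha, hb]
    | smul_tprod s B =>
      rw [PiTensorProduct.smul_tprod_mul_smul_tprod]
      refine PiTensorProduct.ext (MultilinearMap.ext fun v => ?_)
      simp [toEnd_tprod, Module.End.mul_apply, Matrix.mulVec_mulVec, mul_smul, smul_comm r s]

theorem toEnd_surjective : Function.Surjective (toEnd F d n) := by
  intro φ
  let b := Basis.piTensorProduct fun _ : Fin n => Pi.basisFun F (Fin d)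
  -- The preimage is the expansion of `φ` in tensor products of matrix units.
  refine ⟨∑ I : Fin n → Fin d, ∑ K : Fin n → Fin d, b.repr (φ (b K)) I •
    PiTensorProduct.tprod F fun i => Matrix.single (I i) (K i) 1, b.ext fun L => ?_⟩
  have key : ∀ I K : Fin n → Fin d, toEnd F d n (PiTensorProduct.tprod F fun i =>
      Matrix.single (I i) (K i) (1 : F)) (b L) = if K = L then b I else 0 := by
    intro I K
    simp only [b, Basis.piTensorProduct_apply, toEnd_tprod, Pi.basisFun_apply,
      Matrix.mulVec_single_one]
    split_ifs with h
    · subst h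
      congr 1
      ext i j
      simp [Matrix.single_apply, Pi.single_apply, eq_comm]
    · obtain ⟨i, hi⟩ := Function.ne_iff.1 h
      refine MultilinearMap.map_coord_zero _ i ?_
      ext j
      simp [hi]
  simp only [map_sum, map_smul, LinearMap.sum_apply, LinearMap.smul_apply, key, smul_ite, smul_zero,
    Finset.sum_ite_eq', Finset.mem_univ, if_true]
  exact b.sum_repr _

theorem permOp_mul_toEnd_tprod (σ : Equiv.Perm (Fin n)) (A : Fin n → Matrix (Fin d) (Fin d) F) :
    permOp F d σ * toEnd F d n (PiTensorProduct.tprod F A) * permOp F d σ⁻¹ =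
      toEnd F d n (PiTensorProduct.tprod F fun i => A (σ⁻¹ i)) := by
  refine PiTensorProduct.ext (MultilinearMap.ext fun v => ?_)
  simp only [LinearMap.compMultilinearMap_apply, Module.End.mul_apply, permOp_tprod, toEnd_tprod]
  congr 1
  ext i : 1
  simp [Equiv.Perm.inv_def]

/-- The span of the diagonal elements `g ⊗ ⋯ ⊗ g` with `g` invertible contains all diagonal
elements. -/
theorem diag_mem_span_GL [CharZero F] (A : Matrix (Fin d) (Fin d) F) :
    diag n A ∈ Submodule.span F
      (Set.range fun g : GL (Fin d) F => diag n (g : Matrix (Fin d) (Fin d) F)) := by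
  by_contra hA
  obtain ⟨ψ, hψ, hker⟩ := Submodule.exists_le_ker_of_notMem hA
  refine hψ ?_
  -- A form killing the span vanishes at `t + A` unless `t` is an eigenvalue of `-A`. Only finitely
  -- many `t` are excluded, so the polynomial also vanishes at `t = 0`. The double negation matches
  -- the characteristic polynomial of `-A`.
  have hpoly : IsPolyFun fun t : F => ψ (diag n (Matrix.scalar (Fin d) t - -A)) := by
    refine isPolyFun_dual_tprod ψ fun _ a b => ?_
    by_cases hab : a = b
    · subst hab
      simpa using IsPolyFun.id.add (IsPolyFun.const _)
    · simpa [Matrix.diagonal_apply_ne _ hab] using IsPolyFun.const _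
  have hinf : {t : F | ψ (diag n (Matrix.scalar (Fin d) t - -A)) = 0}.Infinite := by
    have hfin : {t : F | (-A).charpoly.IsRoot t}.Finite :=
      Polynomial.finite_setOfPred_isRoot (Matrix.charpoly_monic _).ne_zero
    refine hfin.infinite_compl.mono fun t ht => ?_
    have hdet : (Matrix.scalar (Fin d) t - -A).det ≠ 0 := by
      rwa [← Matrix.eval_charpoly]
    exact hker (Submodule.subset_span ⟨Matrix.GeneralLinearGroup.mkOfDetNeZero _ hdet, rfl⟩)
  simpa using hpoly.eq_zero_of_infinite hinf 0

/-- Every operator commuting with the permutation operators is a linear combination of diagonal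
operators `g ⊗ ⋯ ⊗ g` with `g` invertible. -/
theorem mem_span_diag_of_commute_permOp [CharZero F] (φ : Module.End F (VecPow F d n))
    (hφ : ∀ σ, Commute φ (permOp F d σ)) :
    ∃ T ∈ Submodule.span F
      (Set.range fun g : GL (Fin d) F => diag n (g : Matrix (Fin d) (Fin d) F)),
      toEnd F d n T = φ := by
  set W := Submodule.span F
    (Set.range fun g : GL (Fin d) F => diag n (g : Matrix (Fin d) (Fin d) F))
  have hsym : ∀ S : MatPow F d n,
      ∑ σ, permOp F d σ * toEnd F d n S * permOp F d σ⁻¹ ∈ W.map (toEnd F d n) := by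
    intro S
    induction S using PiTensorProduct.induction_on with
    | add a b ha hb =>
      simp only [map_add, mul_add, add_mul, Finset.sum_add_distrib]
      exact add_mem ha hb
    | smul_tprod r A =>
      simp only [map_smul, mul_smul_comm, smul_mul_assoc, permOp_mul_toEnd_tprod]
      rw [← Finset.smul_sum, ← map_sum]
      refine Submodule.smul_mem _ _ (Submodule.mem_map_of_mem ?_)
      have hinv : ∑ σ : Equiv.Perm (Fin n), PiTensorProduct.tprod F (fun i => A (σ⁻¹ i)) =
          ∑ σ : Equiv.Perm (Fin n), PiTensorProduct.tprod F fun i => A (σ i) :=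
        Equiv.sum_comp (Equiv.inv (Equiv.Perm (Fin n)))
          fun σ : Equiv.Perm (Fin n) => PiTensorProduct.tprod F fun i => A (σ i)
      rw [hinv, ← sum_powerset_map_diagonal]
      exact sum_mem fun T _ => zsmul_mem (diag_mem_span_GL _) _
  obtain ⟨S, hS⟩ := toEnd_surjective φ
  -- Conjugation by permutations fixes `φ`, so the symmetrization is `n!` times `φ`, and `n!` is
  -- invertible.
  have hφS : ∑ σ, permOp F d σ * toEnd F d n S * permOp F d σ⁻¹ =
      (Nat.card (Equiv.Perm (Fin n)) : F) • φ := by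
    have : ∀ σ, permOp F d σ * toEnd F d n S * permOp F d σ⁻¹ = φ := by
      intro σ
      rw [hS, ← (hφ σ).eq, mul_assoc, ← permOp_mul, mul_inv_cancel, permOp_one, mul_one]
    simp [this, ← Nat.cast_smul_eq_nsmul F, Nat.card_eq_fintype_card]
  have hc : (Nat.card (Equiv.Perm (Fin n)) : F) ≠ 0 := Nat.cast_ne_zero.2 Nat.card_pos.ne'
  have := Submodule.smul_mem _ (Nat.card (Equiv.Perm (Fin n)) : F)⁻¹ (hφS ▸ hsym S)
  rwa [inv_smul_smul₀ hc] at this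

/-! ### Double centralizer -/

/-- The action of the symmetric group on a tensor power. -/
noncomputable def permRep (F : Type*) [Field F] (d n : ℕ) :
    Representation F (Equiv.Perm (Fin n)) (VecPow F d n) where
  toFun := permOp F d
  map_one' := permOp_one F d n
  map_mul' := permOp_mul F d

theorem asAlgebraHom_permRep_mem (r : MonoidAlgebra F (Equiv.Perm (Fin n))) :
    (permRep F d n).asAlgebraHom r ∈ permAlgebra F d n := by
  induction r using MonoidAlgebra.induction_on with
  | of σ =>
    rw [Representation.asAlgebraHom_of]
    exact Submodule.subset_span ⟨σ, rfl⟩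
  | add a b ha hb => rw [map_add]; exact add_mem ha hb
  | smul c a ha => rw [map_smul]; exact Subalgebra.smul_mem _ ha c

/-- Double centralizer property of the algebra of permutation operators. -/
theorem mem_permAlgebra_of_commute [CharZero F] (f : Module.End F (VecPow F d n))
    (hf : ∀ φ : Module.End F (VecPow F d n), (∀ σ, Commute φ (permOp F d σ)) → Commute f φ) :
    f ∈ permAlgebra F d n := by
  -- This is the hypothesis of Maschke's theorem, giving the semisimplicity needed for Jacobson
  -- density.
  have : NeZero (Nat.card (Equiv.Perm (Fin n)) : F) := ⟨Nat.cast_ne_zero.2 Nat.card_pos.ne'⟩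
  let e := (permRep F d n).asModuleEquiv
  -- Endomorphisms over the group algebra are operators commuting with all permutations, so `f`
  -- commutes with them.
  have hcomm : ∀ (φ : Module.End (MonoidAlgebra F (Equiv.Perm (Fin n))) (permRep F d n).asModule)
      (x : (permRep F d n).asModule), f (e (φ x)) = e (φ (e.symm (f (e x)))) := by
    intro φ x
    let φ' : Module.End F (VecPow F d n) :=
      e.toLinearMap ∘ₗ φ.restrictScalars F ∘ₗ e.symm.toLinearMap
    have hφ' : ∀ y, φ' y = e (φ (e.symm y)) := fun _ => rfl
    have hperm : ∀ σ y, e.symm (permOp F d σ y) = MonoidAlgebra.of F _ σ • e.symm y :=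
      (permRep F d n).asModuleEquiv_symm_map_rho
    have := hf φ' fun σ => LinearMap.ext fun y => by
      rw [Module.End.mul_apply, Module.End.mul_apply, hφ', hφ', hperm, map_smul,
        ← e.symm_apply_apply (φ (e.symm y)), ← hperm, e.apply_symm_apply, e.apply_symm_apply]
    have := LinearMap.congr_fun this.eq (e x)
    simpa only [Module.End.mul_apply, hφ', e.symm_apply_apply] using this
  let f' : Module.End (Module.End (MonoidAlgebra F (Equiv.Perm (Fin n))) (permRep F d n).asModule)
      (permRep F d n).asModule :=
    { toFun := fun x => e.symm (f (e x))
      map_add' := fun x y => by simp only [map_add]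
      map_smul' := fun φ x => by
        rw [RingHom.id_apply, Module.End.smul_def, Module.End.smul_def, hcomm,
          e.symm_apply_apply] }
  let b := Basis.piTensorProduct fun _ : Fin n => Pi.basisFun F (Fin d)
  classical
  -- Density matches `f'` only on a finite set; a whole basis is such a set.
  obtain ⟨r, hr⟩ := jacobson_density f' (Finset.univ.image fun I => e.symm (b I))
  have : f = (permRep F d n).asAlgebraHom r := by
    refine b.ext fun I => ?_
    have h : e.symm (f (e (e.symm (b I)))) = r • e.symm (b I) := hr _ (by simp)
    have h' := congrArg e h
    rwa [e.apply_symm_apply, e.apply_symm_apply, Representation.asModuleEquiv_map_smul,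
      LinearEquiv.apply_symm_apply] at h'
  rw [this]
  exact asAlgebraHom_permRep_mem r

/-- Invariance means commuting with each `g ⊗ ⋯ ⊗ g`, and these span the commutant of the
permutations. -/
theorem toEnd_mem_permAlgebra_of_isGLInvariant [CharZero F] {J : MatPow F d n}
    (hJ : IsGLInvariant J) : toEnd F d n J ∈ permAlgebra F d n := by
  refine mem_permAlgebra_of_commute _ fun φ hφ => ?_
  obtain ⟨T, hT, rfl⟩ := mem_span_diag_of_commute_permOp φ hφ
  clear hφ
  induction hT using Submodule.span_induction with
  | mem T hT =>
    obtain ⟨g, rfl⟩ := hT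
    have hinv : diag n ((g⁻¹ : GL (Fin d) F) : Matrix (Fin d) (Fin d) F) *
        diag n (g : Matrix (Fin d) (Fin d) F) = 1 := by
      rw [diag, diag, PiTensorProduct.tprod_mul_tprod, PiTensorProduct.one_def]
      congr 1
      ext i : 1
      exact Units.inv_mul g
    rw [Commute, SemiconjBy, ← toEnd_mul, ← toEnd_mul]
    congr 1
    conv_lhs => rw [← hJ g]
    rw [mul_assoc, hinv, mul_one]
  | zero => simp
  | add a b _ _ ha hb => rw [map_add]; exact ha.add_right hb
  | smul c a _ ha => rw [map_smul]; exact ha.smul_right c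

/-! ### The determinant and equivariance -/

/-- The determinant of `d * d` matrices as an alternating map. -/
noncomputable def detVecAlternating (F : Type*) [Field F] (d : ℕ) :
    Matrix (Fin d) (Fin d) F [⋀^Fin (d * d)]→ₗ[F] F :=
  Matrix.detRowAlternating.compLinearMap
    { toFun := vec
      map_add' := fun _ _ => rfl
      map_smul' := fun _ _ => rfl }

theorem detVecAlternating_apply (x : Fin (d * d) → Matrix (Fin d) (Fin d) F) :
    detVecAlternating F d x = detVec x := by
  rw [detVec, ← Matrix.det_transpose]
  rfl

/-- The elementary matrices in lexicographic order. -/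
noncomputable def elemBasis (F : Type*) [Field F] (d : ℕ) :
    Module.Basis (Fin (d * d)) F (Matrix (Fin d) (Fin d) F) :=
  (Matrix.stdBasis F (Fin d) (Fin d)).reindex finProdFinEquiv

theorem detVec_elemBasis : detVec (elemBasis F d) = 1 := by
  rw [detVec, ← Matrix.det_one (n := Fin (d * d))]
  congr 1
  ext p q
  have : elemBasis F d q = Matrix.single (finProdFinEquiv.symm q).1 (finProdFinEquiv.symm q).2 1 := by
    rw [elemBasis, Module.Basis.reindex_apply, Matrix.stdBasis_eq_single]
  simp only [Matrix.of_apply, this, vec, Matrix.one_apply, Matrix.single_apply, ← Prod.ext_iff,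
    finProdFinEquiv.symm.injective.eq_iff, eq_comm]

/-- An alternating map in `d * d` matrix variables is a multiple of the determinant. -/
theorem alternatingMap_eq_detVec_smul {M : Type*} [AddCommGroup M] [Module F M]
    (f : Matrix (Fin d) (Fin d) F [⋀^Fin (d * d)]→ₗ[F] M)
    (x : Fin (d * d) → Matrix (Fin d) (Fin d) F) :
    f x = detVec x • f (elemBasis F d) := by
  have : f = (LinearMap.toSpanSingleton F M (f (elemBasis F d))).compAlternatingMap
      (detVecAlternating F d) := by
    -- Only injective choices of basis vectors matter; these are permutations, and both sides
    -- acquire the same sign.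
    refine (elemBasis F d).ext_alternating fun v hv => ?_
    let σ := Equiv.ofBijective v (Finite.injective_iff_bijective.1 hv)
    change f (elemBasis F d ∘ σ) = detVecAlternating F d (elemBasis F d ∘ σ) • f (elemBasis F d)
    rw [f.map_perm, AlternatingMap.map_perm, detVecAlternating_apply, detVec_elemBasis, smul_assoc,
      one_smul]
  conv_lhs => rw [this]
  rw [← detVecAlternating_apply]
  rfl

/-- The determinant of `d * d` matrices is invariant under simultaneous conjugation. -/
theorem detVec_conj (g : GL (Fin d) F) (x : Fin (d * d) → Matrix (Fin d) (Fin d) F) :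
    detVec (fun q => (g : Matrix (Fin d) (Fin d) F) * x q *
      ((g⁻¹ : GL (Fin d) F) : Matrix (Fin d) (Fin d) F)) = detVec x := by
  set A := (g : Matrix (Fin d) (Fin d) F)
  set B := ((g⁻¹ : GL (Fin d) F) : Matrix (Fin d) (Fin d) F)
  have hAB : A.det * B.det = 1 := by
    rw [← Matrix.det_mul, show A * B = 1 from Units.mul_inv g, Matrix.det_one]
  -- In lexicographic coordinates, `x ↦ A * x * B` is the Kronecker product of `A` and the transpose
  -- of `B`, with determinant `(det A * det B) ^ d = 1`.
  have : (Matrix.of fun p q : Fin (d * d) => vec (A * x q * B) p) =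
      (Matrix.kroneckerMap (· * ·) A B.transpose).submatrix finProdFinEquiv.symm finProdFinEquiv.symm *
        Matrix.of fun p q : Fin (d * d) => vec (x q) p := by
    ext p q
    rw [Matrix.mul_apply, ← finProdFinEquiv.sum_comp, Fintype.sum_prod_type, Finset.sum_comm]
    simp only [Matrix.of_apply, vec, Matrix.mul_apply, Matrix.submatrix_apply,
      Equiv.symm_apply_apply, Matrix.kroneckerMap_apply, Matrix.transpose_apply, Finset.sum_mul]
    exact Finset.sum_congr rfl fun _ _ => Finset.sum_congr rfl fun _ _ => by ring
  rw [detVec, this, Matrix.det_mul, Matrix.det_submatrix_equiv_self, Matrix.det_kronecker,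
    Matrix.det_transpose, ← mul_pow, hAB, one_pow, one_mul]
  rfl

/-- Evaluation of tensor polynomials is equivariant under simultaneous conjugation. -/
theorem evalT_conj {X : Type*} (G : TPoly F X n) (g : GL (Fin d) F)
    (x : X → Matrix (Fin d) (Fin d) F) :
    evalT G (fun j => (g : Matrix (Fin d) (Fin d) F) * x j *
      ((g⁻¹ : GL (Fin d) F) : Matrix (Fin d) (Fin d) F)) =
    diag n (g : Matrix (Fin d) (Fin d) F) * evalT G x *
      diag n ((g⁻¹ : GL (Fin d) F) : Matrix (Fin d) (Fin d) F) := by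
  set A := (g : Matrix (Fin d) (Fin d) F)
  set B := ((g⁻¹ : GL (Fin d) F) : Matrix (Fin d) (Fin d) F)
  have hBA : B * A = 1 := Units.inv_mul g
  have hAB : A * B = 1 := Units.mul_inv g
  have hlift : ∀ w, FreeAlgebra.lift F (fun j => A * x j * B) w =
      A * FreeAlgebra.lift F x w * B := by
    intro w
    induction w using FreeAlgebra.induction with
    | grade0 r =>
      rw [AlgHom.commutes, AlgHom.commutes, ← Algebra.commutes, mul_assoc, hAB, mul_one]
    | grade1 j => simp
    | mul u v hu hv =>
      rw [map_mul, map_mul, hu, hv]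
      calc A * FreeAlgebra.lift F x u * B * (A * FreeAlgebra.lift F x v * B) =
          A * FreeAlgebra.lift F x u * (B * A) * FreeAlgebra.lift F x v * B := by
            simp only [mul_assoc]
        _ = _ := by rw [hBA, mul_one]; simp only [mul_assoc]
    | add u v hu hv => rw [map_add, map_add, hu, hv, mul_add, add_mul]
  induction G using PiTensorProduct.induction_on with
  | add G H hG hH =>
    simp only [evalT, map_add, mul_add, add_mul] at hG hH ⊢
    rw [hG, hH]
  | smul_tprod r w =>
    have hsmul : ∀ y : X → Matrix (Fin d) (Fin d) F, evalT (r • PiTensorProduct.tprod F w) y =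
        r • PiTensorProduct.tprod F fun i => FreeAlgebra.lift F y (w i) := fun y => by
      rw [← evalT_tprod, evalT, map_smul]
      rfl
    rw [hsmul, hsmul, diag, diag, ← one_smul F (PiTensorProduct.tprod F fun _ : Fin n => A),
      PiTensorProduct.smul_tprod_mul_smul_tprod,
      ← one_smul F (PiTensorProduct.tprod F fun _ : Fin n => B),
      PiTensorProduct.smul_tprod_mul_smul_tprod, one_mul, mul_one]
    simp only [hlift]
    rfl

/-- A multiadditive antisymmetric tensor polynomial function as an alternating map. -/
noncomputable def evalTAlternating [CharZero F] {X : Type*} [hX : DecidableEq X]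
    [Fintype X]
    (G : TPoly F X n)
    (hlin : IsMultiadditive fun x : X → Matrix (Fin d) (Fin d) F => evalT G x)
    (halt : IsAntisymmetric F fun x : X → Matrix (Fin d) (Fin d) F => evalT G x) :
    Matrix (Fin d) (Fin d) F [⋀^X]→ₗ[F] MatPow F d n where
  toFun := evalT G
  map_update_add' := by
    intro inst x i a b
    obtain rfl := Subsingleton.elim inst hX
    exact hlin x i a b
  map_update_smul' := by
    intro inst x i c a
    obtain rfl := Subsingleton.elim inst hX
    exact evalT_update_smul G hlin x i c a
  map_eq_zero_of_eq' x i j hx hij := by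
    have h := halt (Equiv.swap i j) x
    have hswap : (fun k => x (Equiv.swap i j k)) = x := by
      ext k : 1
      rcases eq_or_ne k i with rfl | hi
      · rw [Equiv.swap_apply_left, hx]
      rcases eq_or_ne k j with rfl | hj
      · rw [Equiv.swap_apply_right, hx]
      rw [Equiv.swap_apply_of_ne_of_ne hi hj]
    have h1 : ((Equiv.Perm.sign (Equiv.swap i j) : ℤ) : F) = -1 := by
      simp [Equiv.Perm.sign_swap hij]
    -- Swapping two equal arguments makes the value its own negative.
    have h2 : (2 : F) • evalT G x = 0 := by
      rw [two_smul]
      refine eq_neg_iff_add_eq_zero.1 ?_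
      rw [← neg_one_smul F]
      simpa only [hswap, h1] using h
    exact (smul_eq_zero.1 h2).resolve_left two_ne_zero

end
end TensorPoly

theorem mainTheorem8 (F : Type*) [Field F] [CharZero F] (d n : ℕ)
    (G : TensorPoly.TPoly F (Fin (d * d)) n)
    (hlin : TensorPoly.IsMultiadditive
      (fun x : Fin (d * d) → Matrix (Fin d) (Fin d) F => TensorPoly.evalT G x))
    (halt : TensorPoly.IsAntisymmetric F
      (fun x : Fin (d * d) → Matrix (Fin d) (Fin d) F => TensorPoly.evalT G x)) :
    ∃ J : TensorPoly.MatPow F d n,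
      TensorPoly.IsGLInvariant J ∧
      TensorPoly.toEnd F d n J ∈ TensorPoly.permAlgebra F d n ∧
      ∀ x : Fin (d * d) → Matrix (Fin d) (Fin d) F,
        TensorPoly.evalT G x = TensorPoly.detVec x • J := by
  have hG : ∀ x : Fin (d * d) → Matrix (Fin d) (Fin d) F, TensorPoly.evalT G x =
      TensorPoly.detVec x • TensorPoly.evalT G (TensorPoly.elemBasis F d) :=
    TensorPoly.alternatingMap_eq_detVec_smul (TensorPoly.evalTAlternating G hlin halt)
  have hJ : TensorPoly.IsGLInvariant (TensorPoly.evalT G (TensorPoly.elemBasis F d)) := by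
    intro g
    -- Both sides are the value of `G` at the conjugated elementary basis.
    rw [← TensorPoly.evalT_conj, hG, TensorPoly.detVec_conj, TensorPoly.detVec_elemBasis, one_smul]
  exact ⟨_, hJ, TensorPoly.toEnd_mem_permAlgebra_of_isGLInvariant hJ, hG⟩
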